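/- Let $\Bbbk$ be an infinite field and $V$ a finite-dimensional $\Bbbk$-vector space. Let $X\subseteq \mathbb{P}V$ and $L\subseteq\mathbb{P}V^*$ be projective varieties, i.e. sets of $\Bbbk$-points that are common zero loci of homogeneous polynomials; $X$ may be reducible. Let $n=\dim X$, where $\dim X$ is the Krull dimension of the homogeneous coordinate ring of $X$ (the polynomial functions modulo those vanishing on the affine cone over $X$) minus one. Assume that $L$ is irreducible and linearly nondegenerate, i.e. not contained in any proper linear subspace of $\mathbb{P}V^*$. Let $p\in X$. Then there is a nonempty Zariski open subset $\Omega$ of $L^{\times(n+2)}\subseteq(\mathbb{P}V^*)^{\times(n+2)}$ such that for every $(\ell_0,\dots,\ell_{n+1})\in\Omega$ the following holds. Put $W=\{v\in V:\ell_0(v)=\dots=\ell_{n+1}(v)=0\}$. The linear projection \[ \boldsymbol{\ell}:\mathbb{P}V\setminus\mathbb{P}W\to\mathbb{P}(V/W),\qquad [v]\mapsto[v \bmod W], \] is defined on all of $X$, i.e. $X\cap\mathbb{P}W=\emptyset$, and the fiber of its restriction $\boldsymbol{\ell}|_X$ over $\boldsymbol{\ell}(p)$ is exactly one point: $(\boldsymbol{\ell}|_X)^{-1}(\boldsymbol{\ell}(p))=\{p\}$.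 -/

import Mathlib

open scoped LinearAlgebra.Projectivization

namespace ProjGeom

variable {k V : Type*} [Field k] [AddCommGroup V] [Module k V] [FiniteDimensional k V]

/-- The coordinates of a vector with respect to a fixed basis of `V`. The notions below do not
depend on the basis, since a linear change of coordinates preserves (multi)homogeneity. -/
noncomputable def coords (v : V) : Fin (Module.finrank k V) → k :=
  (Module.finBasis k V).repr v

/-- Zariski closed subsets of `ℙ k V`, that is, projective varieties (possibly reducible):
common zero loci of families of homogeneous polynomials. -/
def IsZariskiClosed (Z : Set (ℙ k V)) : Prop :=
  ∃ S : Set (MvPolynomial (Fin (Module.finrank k V)) k),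
    (∀ f ∈ S, ∃ d : ℕ, f.IsHomogeneous d) ∧
      Z = {p | ∀ f ∈ S, MvPolynomial.eval (coords (k := k) p.rep) f = 0}

/-- A polynomial in `m` groups of variables is multihomogeneous of multidegree `d` if it is
homogeneous of degree `d i` in the `i`-th group of variables, for every `i`. -/
def IsMultihomogeneous {m N : ℕ} (f : MvPolynomial (Fin m × Fin N) k) (d : Fin m → ℕ) : Prop :=
  MvPolynomial.IsWeightedHomogeneous (fun x : Fin m × Fin N => (Pi.single x.1 1 : Fin m → ℕ)) f d

/-- Zariski closed subsets of the `m`-fold product `ℙ k V × ⋯ × ℙ k V`: common zero loci of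
families of multihomogeneous polynomials. -/
def IsZariskiClosedProd {m : ℕ} (Z : Set (Fin m → ℙ k V)) : Prop :=
  ∃ S : Set (MvPolynomial (Fin m × Fin (Module.finrank k V)) k),
    (∀ f ∈ S, ∃ d : Fin m → ℕ, IsMultihomogeneous f d) ∧
      Z = {p | ∀ f ∈ S,
        MvPolynomial.eval (fun x : Fin m × Fin (Module.finrank k V) =>
          coords (k := k) (p x.1).rep x.2) f = 0}

/-- `Z` is irreducible: nonempty, and not the union of two proper Zariski closed subsets. -/
def IsIrreducibleVariety (Z : Set (ℙ k V)) : Prop :=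
  Z.Nonempty ∧ ∀ A B : Set (ℙ k V), IsZariskiClosed A → IsZariskiClosed B →
    Z ⊆ A ∪ B → Z ⊆ A ∨ Z ⊆ B

/-- `Z` is linearly nondegenerate: it is not contained in any proper linear subspace. -/
def IsLinearlyNondegenerate (Z : Set (ℙ k V)) : Prop :=
  ∀ H : Submodule k V, H ≠ ⊤ → ∃ p ∈ Z, ¬ p.submodule ≤ H

/-- The affine cone over `X`. -/
def affineCone (X : Set (ℙ k V)) : Set V :=
  {v | v = 0 ∨ ∃ h : v ≠ 0, Projectivization.mk k v h ∈ X}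

/-- The homogeneous coordinate ring of `X`: polynomials modulo those vanishing on the affine
cone over `X`. -/
abbrev HomogeneousCoordinateRing (X : Set (ℙ k V)) : Type _ :=
  MvPolynomial (Fin (Module.finrank k V)) k ⧸
    MvPolynomial.vanishingIdeal k (coords (k := k) '' affineCone X)

/-- `X` has dimension `n`: its homogeneous coordinate ring has Krull dimension `n + 1`. -/
def HasDimension (X : Set (ℙ k V)) (n : ℕ) : Prop :=
  ringKrullDim (HomogeneousCoordinateRing X) = ((n + 1 : ℕ) : WithBot ℕ∞)

/-- A property holds for a generic tuple in `L × ⋯ × L` (`m` factors) if it holds for all tuples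
in some nonempty Zariski open subset of `L × ⋯ × L`, the complement of the closed set `Z`. -/
def GenericTuple (L : Set (ℙ k V)) (m : ℕ) (P : (Fin m → ℙ k V) → Prop) : Prop :=
  ∃ Z : Set (Fin m → ℙ k V), IsZariskiClosedProd Z ∧
    (∃ ℓ : Fin m → ℙ k V, (∀ i, ℓ i ∈ L) ∧ ℓ ∉ Z) ∧
    ∀ ℓ : Fin m → ℙ k V, (∀ i, ℓ i ∈ L) → ℓ ∉ Z → P ℓ

end ProjGeom

namespace ProjGeom

variable {k V : Type*} [Field k] [AddCommGroup V] [Module k V]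

/-- The linear subspace of `V` annihilated by all linear forms `ℓ i`; its projectivization is
`⟨ℓ₀, …, ℓₘ₋₁⟩^⊥ ⊆ ℙ k V`. -/
def annihilator {m : ℕ} (ℓ : Fin m → ℙ k (Module.Dual k V)) : Submodule k V :=
  (⨆ i, (ℓ i).submodule).dualCoannihilator

/-- The points of `ℙ k V` outside the projectivization of `W`: the domain of definition of the
linear projection from `W`. -/
def projectionDomain (W : Submodule k V) : Set (ℙ k V) :=
  {p | ¬ p.submodule ≤ W}

theorem mkQ_rep_ne_zero (W : Submodule k V) (p : projectionDomain W) :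
    W.mkQ p.1.rep ≠ 0 := by
  intro h
  apply p.2
  rw [Projectivization.submodule_eq, Submodule.span_singleton_le_iff_mem]
  simpa using h

/-- The linear projection `ℙ V ⇢ ℙ (V / W)`, `[v] ↦ [v mod W]`, on its domain of definition. -/
noncomputable def linearProjection (W : Submodule k V) (p : projectionDomain W) :
    ℙ k (V ⧸ W) :=
  Projectivization.mk k (W.mkQ p.1.rep) (mkQ_rep_ne_zero W p)

end ProjGeom

/-!
Let `C` be the affine cone over the join of `X` with `p`. Evaluation of polynomials on `C` factors
through the polynomial ring in one variable over the coordinate ring of `X`, so the coordinate ring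
of `C` has dimension at most `n + 2`. If the common kernel `W` of the `ℓ i` meets `C` only in `0`,
then it misses `X`, and a point `q` of `X` with the same image as `p` satisfies
`q.rep - c • p.rep ∈ W ∩ C = 0` for some `c`, so that `q = p`.

To see that `W ∩ C = 0` for generic `ℓ i ∈ L`, let `I` be the ideal of `C`. As `L` is irreducible
and nondegenerate, it contains a form outside all minimal primes of `I`, unless one of them contains
the irrelevant ideal; adjoining such a form to `I` drops the dimension of the quotient. After
`n + 2` steps all forms of some degree lie in `I + (ℓ)`. This condition is open, as the nonvanishing
of a determinant is, and it forces the common zeros of the `ℓ i` on `C` to be `0`.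
-/

namespace ProjGeom

section KrullDimension

theorem ringKrullDim_le_of_isIntegral (A B : Type*) [CommRing A] [CommRing B] [Algebra A B]
    [Algebra.IsIntegral A B] : ringKrullDim B ≤ ringKrullDim A :=
  Order.krullDim_le_of_strictMono (PrimeSpectrum.comap (algebraMap A B)) fun _ _ h =>
    Ideal.IsIntegral.comap_lt_comap h

theorem ringKrullDim_eq_of_isIntegral_of_injective {A B : Type*} [CommRing A] [CommRing B]
    [Algebra A B] [Algebra.IsIntegral A B] (hinj : Function.Injective (algebraMap A B)) :
    ringKrullDim B = ringKrullDim A := by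
  refine le_antisymm (ringKrullDim_le_of_isIntegral A B) (iSup_le fun l => ?_)
  obtain ⟨P, -, _, hP⟩ := Ideal.exists_ideal_over_prime_of_isIntegral l.head.asIdeal (⊥ : Ideal B)
    (by rw [← RingHom.ker_eq_comap_bot, (RingHom.injective_iff_ker_eq_bot _).1 hinj]; exact bot_le)
  have : P.LiesOver l.head.asIdeal := ⟨hP.symm⟩
  obtain ⟨l', hlength, -⟩ := Ideal.exists_ltSeries_of_hasGoingUp l P
  exact hlength ▸ Order.LTSeries.length_le_krullDim l'

variable {k A B : Type*} [Field k] [CommRing A] [CommRing B] [Algebra k A] [Algebra k B]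
  [Algebra.FiniteType k B]

theorem natCast_le_ringKrullDim_of_mvPolynomial_injective_of_isDomain [IsDomain B] {r : ℕ}
    (φ : MvPolynomial (Fin r) k →ₐ[k] B) (hφ : Function.Injective φ) : r ≤ ringKrullDim B := by
  obtain ⟨s, ψ, hψ, hψint⟩ := exists_integral_inj_algHom_of_fg k B
  let := ψ.toRingHom.toAlgebra
  have : Algebra.IsIntegral (MvPolynomial (Fin s) k) B := ⟨hψint⟩
  have : IsScalarTower k (MvPolynomial (Fin s) k) B :=
    IsScalarTower.of_algebraMap_eq fun x => (ψ.commutes x).symm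
  have : FaithfulSMul (MvPolynomial (Fin s) k) B :=
    (faithfulSMul_iff_algebraMap_injective _ _).2 hψ
  have hdim : ringKrullDim B = s := by
    rw [ringKrullDim_eq_of_isIntegral_of_injective (A := MvPolynomial (Fin s) k) hψ,
      MvPolynomial.ringKrullDim_of_isNoetherianRing]
    simp
  have htrdeg : Algebra.trdeg k B = s := by
    have := ((IsTranscendenceBasis.mvPolynomial (Fin s) k).algebraMap_comp
      (A := B)).lift_cardinalMk_eq_trdeg
    simpa using this.symm
  have hrs := lift_trdeg_le_of_injective φ hφ
  rw [MvPolynomial.trdeg_of_isDomain, htrdeg] at hrs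
  rw [hdim]
  exact_mod_cast (by simpa using hrs : r ≤ s)

theorem natCast_le_ringKrullDim_of_mvPolynomial_injective {r : ℕ}
    (φ : MvPolynomial (Fin r) k →ₐ[k] B) (hφ : Function.Injective φ) : r ≤ ringKrullDim B := by
  obtain ⟨Q, hQ, hQφ⟩ := Ideal.exists_comap_eq_of_mem_minimalPrimes_of_injective
    (f := φ.toRingHom) hφ ⊥ (by simp [IsDomain.minimalPrimes_eq_singleton_bot])
  refine le_trans ?_ (ringKrullDim_quotient_le Q)
  refine natCast_le_ringKrullDim_of_mvPolynomial_injective_of_isDomain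
    ((Ideal.Quotient.mkₐ k Q).comp φ) ((injective_iff_map_eq_zero _).2 fun x hx => ?_)
  have : x ∈ Q.comap φ.toRingHom := Ideal.mem_comap.2 (Ideal.Quotient.eq_zero_iff_mem.1 hx)
  rwa [hQφ] at this

theorem ringKrullDim_le_of_injective_algHom [Algebra.FiniteType k A] (φ : A →ₐ[k] B)
    (hφ : Function.Injective φ) : ringKrullDim A ≤ ringKrullDim B := by
  nontriviality A using ringKrullDim_eq_bot_of_subsingleton
  obtain ⟨r, ψ, hψ, hψint⟩ := exists_integral_inj_algHom_of_fg k A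
  let := ψ.toRingHom.toAlgebra
  have : Algebra.IsIntegral (MvPolynomial (Fin r) k) A := ⟨hψint⟩
  calc ringKrullDim A ≤ ringKrullDim (MvPolynomial (Fin r) k) := ringKrullDim_le_of_isIntegral _ _
    _ = r := by rw [MvPolynomial.ringKrullDim_of_isNoetherianRing]; simp
    _ ≤ ringKrullDim B :=
      natCast_le_ringKrullDim_of_mvPolynomial_injective (φ.comp ψ) (hφ.comp hψ)

theorem ringKrullDim_quotient_le_of_ker_le [Algebra.FiniteType k A] (φ : A →ₐ[k] B) {I : Ideal A}
    (hI : RingHom.ker φ ≤ I) : ringKrullDim (A ⧸ I) ≤ ringKrullDim B :=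
  (ringKrullDim_le_of_surjective _ (Ideal.Quotient.factor_surjective hI)).trans
    (ringKrullDim_le_of_injective_algHom _ (Ideal.kerLiftAlg_injective φ))

theorem ringKrullDim_quotient_sup_span_singleton_add_one_le {R : Type*} [CommRing R]
    {I : Ideal R} {t : R} (ht : ∀ P ∈ I.minimalPrimes, t ∉ P) :
    ringKrullDim (R ⧸ (I ⊔ Ideal.span {t})) + 1 ≤ ringKrullDim (R ⧸ I) := by
  have h := Module.supportDim_quotSMulTop_succ_le_of_notMem_minimalPrimes (R := R) (M := R ⧸ I)
    (x := t) (by rwa [Ideal.annihilator_quotient])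
  rwa [Module.supportDim, Module.support_quotSMulTop, Module.support_eq_zeroLocus,
    Ideal.annihilator_quotient, ← PrimeSpectrum.zeroLocus_span {t}, ← PrimeSpectrum.zeroLocus_sup,
    ← ringKrullDim_quotient, Module.supportDim_quotient_eq_ringKrullDim] at h

end KrullDimension

section Join

open MvPolynomial Pointwise

variable {σ k : Type*} [Field k] [Finite σ]

theorem ringKrullDim_quotient_vanishingIdeal_add_span_singleton_le (C : Set (σ → k)) (w : σ → k) :
    ringKrullDim (MvPolynomial σ k ⧸ vanishingIdeal k (C + (k ∙ w : Set (σ → k)))) ≤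
      ringKrullDim (MvPolynomial σ k ⧸ vanishingIdeal k C) + 1 := by
  set I := vanishingIdeal k C
  let φ : MvPolynomial σ k →ₐ[k] Polynomial (MvPolynomial σ k ⧸ I) := aeval fun j =>
    Polynomial.C (Ideal.Quotient.mk I (X j)) + w j • Polynomial.X
  rw [← Polynomial.ringKrullDim_of_isNoetherianRing]
  have : Algebra.FiniteType k (Polynomial (MvPolynomial σ k ⧸ I)) :=
    .trans (S := MvPolynomial σ k ⧸ I) inferInstance inferInstance
  refine ringKrullDim_quotient_le_of_ker_le φ ?_
  rintro f hf _ ⟨v, hv, _, hw, rfl⟩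
  obtain ⟨c, rfl⟩ := Submodule.mem_span_singleton.1 hw
  let evalAt : Polynomial (MvPolynomial σ k ⧸ I) →ₐ[k] k := Polynomial.aevalTower
    (Ideal.Quotient.liftₐ I (aeval v) fun g hg => hg v hv) c
  have hevalAt : evalAt.comp φ = aeval (v + c • w) := by
    ext j
    simp [evalAt, φ, mul_comm c]
  change aeval (v + c • w) f = 0
  rw [← hevalAt, AlgHom.comp_apply, RingHom.mem_ker.1 hf, map_zero]

end Join

section HomogeneousIdeals

open MvPolynomial

attribute [local instance] MvPolynomial.gradedAlgebra

variable {σ R k : Type*} [CommRing R] [Field k]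

theorem eval_smul_of_isHomogeneous {f : MvPolynomial σ R} {n : ℕ}
    (hf : f.IsHomogeneous n) (c : R) (v : σ → R) : eval (c • v) f = c ^ n * eval v f := by
  simp only [eval_eq, Finset.mul_sum]
  refine Finset.sum_congr rfl fun d hd => ?_
  rw [hf.degree_eq_sum_deg_support hd, ← Finset.prod_pow_eq_pow_sum]
  simp only [Pi.smul_apply, smul_eq_mul, mul_pow, Finset.prod_mul_distrib]
  ring

theorem homogeneousComponent_mul_of_isHomogeneous {f : MvPolynomial σ R} {m : ℕ}
    (hf : f.IsHomogeneous m) (g : MvPolynomial σ R) (n : ℕ) :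
    homogeneousComponent (m + n) (f * g) = f * homogeneousComponent n g := by
  rw [← decomposition.decompose'_apply, ← decomposition.decompose'_apply]
  exact DirectSum.coe_decompose_mul_add_of_left_mem (homogeneousSubmodule σ R) hf

theorem exists_isHomogeneous_sub_sum_mul_mem {ι : Type*} [Fintype ι]
    {I : Ideal (MvPolynomial σ R)} (hI : I.IsHomogeneous (homogeneousSubmodule σ R))
    {t : ι → MvPolynomial σ R} {e d : ℕ} (ht : ∀ i, (t i).IsHomogeneous e)
    {f : MvPolynomial σ R} (hf : f.IsHomogeneous (e + d))
    (hfJ : f ∈ I ⊔ Ideal.span (Set.range t)) :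
    ∃ g : ι → MvPolynomial σ R, (∀ i, (g i).IsHomogeneous d) ∧ f - ∑ i, t i * g i ∈ I := by
  obtain ⟨a, ha, b, hb, rfl⟩ := Submodule.mem_sup.1 hfJ
  obtain ⟨c, rfl⟩ := Ideal.mem_span_range_iff_exists_fun.1 hb
  refine ⟨fun i => homogeneousComponent d (c i),
    fun i => homogeneousComponent_isHomogeneous d _, ?_⟩
  convert homogeneousComponent_mem_of_mem hI ha (e + d) using 1
  rw [sub_eq_iff_eq_add, ← homogeneousComponent_eq_self hf, map_add, map_sum]
  simp only [mul_comm (c _), homogeneousComponent_mul_of_isHomogeneous (ht _)]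

theorem homogeneousSubmodule_le_sup_span_range_iff {ι : Type*} [Finite ι]
    {I : Ideal (MvPolynomial σ R)} (hI : I.IsHomogeneous (homogeneousSubmodule σ R))
    {t : ι → MvPolynomial σ R} {e d : ℕ} (ht : ∀ i, (t i).IsHomogeneous e) :
    homogeneousSubmodule σ R (e + d) ≤ (I ⊔ Ideal.span (Set.range t)).restrictScalars R ↔
      Submodule.span R (Set.range fun x : ι × homogeneousSubmodule σ R d =>
        Ideal.Quotient.mkₐ R I (t x.1 * x.2)) =
          (homogeneousSubmodule σ R (e + d)).map (Ideal.Quotient.mkₐ R I).toLinearMap := by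
  have := Fintype.ofFinite ι
  refine ⟨fun hle => le_antisymm ?_ ?_, fun heq f hf => ?_⟩
  · rw [Submodule.span_le]
    rintro _ ⟨⟨i, g⟩, rfl⟩
    exact Submodule.mem_map_of_mem ((ht i).mul g.2)
  · rintro _ ⟨f, hf, rfl⟩
    obtain ⟨g, hg, hfg⟩ := exists_isHomogeneous_sub_sum_mul_mem hI ht hf (hle hf)
    have hsum : Ideal.Quotient.mkₐ R I f = ∑ i, Ideal.Quotient.mkₐ R I (t i * g i) := by
      rw [← map_sum]
      exact Ideal.Quotient.eq.2 hfg
    rw [AlgHom.toLinearMap_apply, hsum]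
    exact Submodule.sum_mem _ fun i _ => Submodule.subset_span ⟨(i, ⟨g i, hg i⟩), rfl⟩
  · set J := I ⊔ Ideal.span (Set.range t)
    have hspan : Submodule.span R (Set.range fun x : ι × homogeneousSubmodule σ R d =>
        Ideal.Quotient.mkₐ R I (t x.1 * x.2)) ≤
          (J.map (Ideal.Quotient.mk I)).restrictScalars R := by
      rw [Submodule.span_le]
      rintro _ ⟨⟨i, g⟩, rfl⟩
      exact Ideal.mem_map_of_mem _ (J.mul_mem_right _
        (Ideal.mem_sup_right (Ideal.subset_span ⟨i, rfl⟩)))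
    exact (Ideal.mem_quotient_iff_mem le_sup_left).1
      (hspan (heq ▸ Submodule.mem_map_of_mem hf))

theorem mem_idealOfVars_iff {f : MvPolynomial σ R} :
    f ∈ idealOfVars σ R ↔ constantCoeff f = 0 := by
  rw [← pow_one (idealOfVars σ R), mem_pow_idealOfVars_iff']
  simp [constantCoeff_eq, Finsupp.degree_eq_zero_iff]

theorem exists_forall_homogeneousSubmodule_le_of_idealOfVars_le_radical [Finite σ]
    {J : Ideal (MvPolynomial σ R)} (hJ : idealOfVars σ R ≤ J.radical) :
    ∃ d₀, ∀ d ≥ d₀, homogeneousSubmodule σ R d ≤ J.restrictScalars R := by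
  obtain ⟨d₀, hd₀⟩ := Ideal.exists_pow_le_of_le_radical_of_fg hJ (idealOfVars_fg σ R)
  refine ⟨d₀, fun d hd f hf => hd₀ ((mem_pow_idealOfVars_iff' _ _).2 fun x hx => ?_)⟩
  exact IsHomogeneous.coeff_eq_zero hf (by omega)

theorem isHomogeneous_of_mem_minimalPrimes {I P : Ideal (MvPolynomial σ R)}
    (hI : I.IsHomogeneous (homogeneousSubmodule σ R)) (hP : P ∈ I.minimalPrimes) :
    P.IsHomogeneous (homogeneousSubmodule σ R) := by
  have hcore : (P.homogeneousCore (homogeneousSubmodule σ R)).toIdeal ≤ P :=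
    P.toIdeal_homogeneousCore_le _
  have hIcore : I ≤ (P.homogeneousCore (homogeneousSubmodule σ R)).toIdeal := by
    rw [← hI.toIdeal_homogeneousCore_eq_self]
    exact Ideal.homogeneousCore_mono _ hP.1.2
  rw [Ideal.IsHomogeneous.iff_eq]
  exact hcore.antisymm (hP.2 ⟨hP.1.1.homogeneousCore, hIcore⟩ hcore)

theorem isHomogeneous_vanishingIdeal [Infinite k] {C : Set (σ → k)}
    (hC : ∀ c : k, ∀ v ∈ C, c • v ∈ C) :
    (vanishingIdeal k C).IsHomogeneous (homogeneousSubmodule σ k) := by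
  intro n f hf v hv
  -- The values of `f` on the line through `v` are those of `q`, whose `n`-th coefficient is the
  -- value at `v` of the `n`-th component of `f`.
  let q : Polynomial k := ∑ i ∈ Finset.range (f.totalDegree + 1),
    Polynomial.monomial i (eval v (homogeneousComponent i f))
  have hq : q = 0 := Polynomial.funext fun c => by
    have hfc : eval (c • v) f = 0 := hf _ (hC c v hv)
    rw [← sum_homogeneousComponent f, map_sum] at hfc
    simpa [q, Polynomial.eval_finsetSum, mul_comm,
      eval_smul_of_isHomogeneous (homogeneousComponent_isHomogeneous _ f)] using hfc
  change eval v (decomposition.decompose' f n : MvPolynomial σ k) = 0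
  rw [decomposition.decompose'_apply]
  rcases lt_or_ge f.totalDegree n with hn | hn
  · rw [homogeneousComponent_eq_zero _ _ hn, map_zero]
  · simpa [q, Polynomial.finsetSum_coeff, Polynomial.coeff_monomial, Nat.lt_succ_iff, hn]
      using congrArg (Polynomial.coeff · n) hq

theorem le_idealOfVars_of_isHomogeneous {I : Ideal (MvPolynomial σ k)}
    (hI : I.IsHomogeneous (homogeneousSubmodule σ k)) (hI_ne_top : I ≠ ⊤) :
    I ≤ idealOfVars σ k := by
  intro f hf
  rw [mem_idealOfVars_iff]
  by_contra hf0
  have hC : C (constantCoeff f) ∈ I := by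
    simpa [constantCoeff_eq] using homogeneousComponent_mem_of_mem hI hf 0
  exact hI_ne_top (I.eq_top_of_isUnit_mem hC ((isUnit_iff_ne_zero.2 hf0).map C))

theorem le_idealOfVars_of_mem_minimalPrimes {I P : Ideal (MvPolynomial σ k)}
    (hI : I.IsHomogeneous (homogeneousSubmodule σ k)) (hP : P ∈ I.minimalPrimes) :
    P ≤ idealOfVars σ k :=
  le_idealOfVars_of_isHomogeneous (isHomogeneous_of_mem_minimalPrimes hI hP) hP.1.1.ne_top

theorem idealOfVars_le_radical_of_mem_minimalPrimes_of_le {I P : Ideal (MvPolynomial σ k)}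
    (hI : I.IsHomogeneous (homogeneousSubmodule σ k)) (hP : P ∈ I.minimalPrimes)
    (hle : idealOfVars σ k ≤ P) : idealOfVars σ k ≤ I.radical := by
  rw [← Ideal.sInf_minimalPrimes]
  refine le_sInf fun Q hQ => hle.trans ?_
  exact hP.2 hQ.1 ((le_idealOfVars_of_mem_minimalPrimes hI hQ).trans hle)

theorem idealOfVars_le_radical_of_ringKrullDim_le_zero {I : Ideal (MvPolynomial σ k)}
    (hI : I.IsHomogeneous (homogeneousSubmodule σ k))
    (hdim : ringKrullDim (MvPolynomial σ k ⧸ I) ≤ 0) : idealOfVars σ k ≤ I.radical := by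
  have hmax := Ideal.krullDimLE_zero_quotient_iff_forall_minimalPrimes_isMaximal.1
    (Ring.krullDimLE_iff.2 (by simpa using hdim))
  have htop : idealOfVars σ k ≠ ⊤ := (Ideal.ne_top_iff_one _).2 (by simp [mem_idealOfVars_iff])
  rw [← Ideal.sInf_minimalPrimes]
  exact le_sInf fun P hP =>
    ((hmax P hP).eq_of_le htop (le_idealOfVars_of_mem_minimalPrimes hI hP)).ge

theorem exists_idealOfVars_le_radical_sup_span_range [Finite σ] {T : Set (MvPolynomial σ k)}
    (hT_homogeneous : ∀ t ∈ T, SetLike.IsHomogeneousElem (homogeneousSubmodule σ k) t)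
    (hT_avoid : ∀ F : Set (Ideal (MvPolynomial σ k)), F.Finite →
      (∀ P ∈ F, ¬ idealOfVars σ k ≤ P) → ∃ t ∈ T, ∀ P ∈ F, t ∉ P)
    {m : ℕ} {I : Ideal (MvPolynomial σ k)} (hI : I.IsHomogeneous (homogeneousSubmodule σ k))
    (hdim : ringKrullDim (MvPolynomial σ k ⧸ I) ≤ m) :
    ∃ t : Fin m → MvPolynomial σ k, (∀ i, t i ∈ T) ∧
      idealOfVars σ k ≤ (I ⊔ Ideal.span (Set.range t)).radical := by
  induction m generalizing I with
  | zero =>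
    refine ⟨Fin.elim0, fun i => i.elim0, ?_⟩
    simpa using idealOfVars_le_radical_of_ringKrullDim_le_zero hI hdim
  | succ m ih =>
    by_cases hrad : idealOfVars σ k ≤ I.radical
    · obtain ⟨t, ht, -⟩ := hT_avoid ∅ Set.finite_empty (by simp)
      exact ⟨fun _ => t, fun _ => ht, hrad.trans (Ideal.radical_mono le_sup_left)⟩
    obtain ⟨t₀, ht₀, ht₀_notMem⟩ := hT_avoid I.minimalPrimes
      I.finite_minimalPrimes_of_isNoetherianRing fun P hP hle =>
        hrad (idealOfVars_le_radical_of_mem_minimalPrimes_of_le hI hP hle)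
    have hdim' : ringKrullDim (MvPolynomial σ k ⧸ (I ⊔ Ideal.span {t₀})) ≤ m :=
      ENat.WithBot.add_le_add_one_right_iff.1
        ((ringKrullDim_quotient_sup_span_singleton_add_one_le ht₀_notMem).trans hdim)
    obtain ⟨t, ht, hrad_t⟩ :=
      ih (hI.sup (Ideal.homogeneous_span _ _ (by simpa using hT_homogeneous t₀ ht₀))) hdim'
    refine ⟨Fin.cons t₀ t, Fin.cases ht₀ ht, ?_⟩
    rwa [Fin.range_cons, Set.insert_eq, Ideal.span_union, ← sup_assoc]

end HomogeneousIdeals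

section LinearPolynomial

open MvPolynomial

variable {k V : Type*} [Field k] [AddCommGroup V] [Module k V] [FiniteDimensional k V]

/-- A linear form on `V` as a homogeneous polynomial of degree one in the coordinates `coords`. -/
noncomputable def linearPolynomial :
    Module.Dual k V →ₗ[k] MvPolynomial (Fin (Module.finrank k V)) k where
  toFun φ := ∑ j, φ (Module.finBasis k V j) • X j
  map_add' φ ψ := by simp [add_smul, Finset.sum_add_distrib]
  map_smul' c φ := by simp [mul_smul, Finset.smul_sum]

theorem linearPolynomial_apply (φ : Module.Dual k V) :
    linearPolynomial φ = ∑ j, φ (Module.finBasis k V j) • X j :=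
  rfl

theorem isHomogeneous_linearPolynomial (φ : Module.Dual k V) :
    (linearPolynomial φ).IsHomogeneous 1 :=
  IsHomogeneous.sum _ _ _ fun j _ =>
    (homogeneousSubmodule _ k 1).smul_mem _ (isHomogeneous_X k j)

theorem eval_coords_linearPolynomial (φ : Module.Dual k V) (v : V) :
    eval (coords (k := k) v) (linearPolynomial φ) = φ v := by
  conv_rhs => rw [← (Module.finBasis k V).sum_repr v, map_sum]
  simp [linearPolynomial_apply, coords, smul_eval, mul_comm]

theorem linearPolynomial_coord (j : Fin (Module.finrank k V)) :
    linearPolynomial ((Module.finBasis k V).coord j) = X j := by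
  simp [linearPolynomial_apply, Finsupp.single_apply, ite_smul]

end LinearPolynomial

section Irreducible

open MvPolynomial

variable {k V : Type*} [Field k] [AddCommGroup V] [Module k V] [FiniteDimensional k V]
  {Z : Set (ℙ k V)}

theorem isZariskiClosed_setOf_eval_eq_zero {f : MvPolynomial (Fin (Module.finrank k V)) k} {d : ℕ}
    (hf : f.IsHomogeneous d) :
    IsZariskiClosed {p : ℙ k V | eval (coords (k := k) p.rep) f = 0} :=
  ⟨{f}, by simpa using ⟨d, hf⟩, by simp⟩

theorem IsIrreducibleVariety.exists_eval_mul_ne_zero (hZ : IsIrreducibleVariety Z)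
    {f g : MvPolynomial (Fin (Module.finrank k V)) k} {d e : ℕ}
    (hf : f.IsHomogeneous d) (hg : g.IsHomogeneous e)
    (hfZ : ∃ p ∈ Z, eval (coords (k := k) p.rep) f ≠ 0)
    (hgZ : ∃ p ∈ Z, eval (coords (k := k) p.rep) g ≠ 0) :
    ∃ p ∈ Z, eval (coords (k := k) p.rep) (f * g) ≠ 0 := by
  by_contra! hfg
  rcases hZ.2 _ _ (isZariskiClosed_setOf_eval_eq_zero hf) (isZariskiClosed_setOf_eval_eq_zero hg)
    fun p hp => by simpa using hfg p hp with hZf | hZg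
  · obtain ⟨p, hp, hpf⟩ := hfZ
    exact hpf (hZf hp)
  · obtain ⟨p, hp, hpg⟩ := hgZ
    exact hpg (hZg hp)

theorem IsIrreducibleVariety.exists_eval_prod_ne_zero (hZ : IsIrreducibleVariety Z) {ι : Type*}
    (s : Finset ι) {f : ι → MvPolynomial (Fin (Module.finrank k V)) k} {d : ι → ℕ}
    (hf : ∀ i ∈ s, (f i).IsHomogeneous (d i))
    (hfZ : ∀ i ∈ s, ∃ p ∈ Z, eval (coords (k := k) p.rep) (f i) ≠ 0) :
    ∃ p ∈ Z, eval (coords (k := k) p.rep) (∏ i ∈ s, f i) ≠ 0 := by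
  induction s using Finset.cons_induction with
  | empty => simpa [Set.Nonempty] using hZ.1
  | cons i s hi ih =>
    simp only [Finset.forall_mem_cons] at hf hfZ
    rw [Finset.prod_cons]
    exact hZ.exists_eval_mul_ne_zero hf.1 (IsHomogeneous.prod _ _ _ hf.2) hfZ.1 (ih hf.2 hfZ.2)

theorem IsIrreducibleVariety.exists_forall_rep_notMem (hZ : IsIrreducibleVariety Z)
    (hZnd : IsLinearlyNondegenerate Z) {s : Set (Submodule k V)} (hs : s.Finite)
    (hproper : ∀ H ∈ s, H ≠ ⊤) : ∃ p ∈ Z, ∀ H ∈ s, p.rep ∉ H := by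
  have hφ : ∀ H ∈ s, ∃ φ : Module.Dual k V, φ ≠ 0 ∧ H ≤ LinearMap.ker φ := fun H hH =>
    H.exists_le_ker_of_lt_top (hproper H hH).lt_top
  choose! φ hφ_ne_zero hφ using hφ
  obtain ⟨p, hp, hpφ⟩ := hZ.exists_eval_prod_ne_zero hs.toFinset
    (fun H _ => isHomogeneous_linearPolynomial (φ H)) fun H hH => by
      obtain ⟨p, hp, hpH⟩ := hZnd (LinearMap.ker (φ H))
        (LinearMap.ker_eq_top.not.2 (hφ_ne_zero H (hs.mem_toFinset.1 hH)))
      refine ⟨p, hp, ?_⟩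
      rwa [eval_coords_linearPolynomial, Ne, ← LinearMap.mem_ker,
        ← Submodule.span_singleton_le_iff_mem, ← Projectivization.submodule_eq]
  refine ⟨p, hp, fun H hH hpH => hpφ ?_⟩
  rw [map_prod]
  refine Finset.prod_eq_zero (hs.mem_toFinset.2 hH) ?_
  rw [eval_coords_linearPolynomial]
  exact hφ H hH hpH

end Irreducible

section Multihomogeneous

open MvPolynomial

variable {k D E : Type*} [Field k] [AddCommGroup D] [Module k D] [FiniteDimensional k D]
  [AddCommGroup E] [Module k E]

theorem isWeightedHomogeneous_det {κ τ R M : Type*} [Fintype κ] [DecidableEq κ] [CommRing R]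
    [AddCommMonoid M] {w : τ → M} {e : κ → M} {N : Matrix κ κ (MvPolynomial τ R)}
    (hN : ∀ s r, IsWeightedHomogeneous w (N s r) (e r)) :
    IsWeightedHomogeneous w N.det (∑ r, e r) := by
  rw [Matrix.det_apply]
  refine IsWeightedHomogeneous.sum _ _ _ fun τ _ => ?_
  rw [Units.smul_def, zsmul_eq_mul, ← map_intCast (C (R := R))]
  exact (IsWeightedHomogeneous.prod _ _ _ fun r _ => hN _ r).C_mul _

theorem isMultihomogeneous_rename_linearPolynomial {m : ℕ} (i : Fin m) (ψ : Module.Dual k D) :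
    IsMultihomogeneous (rename (Prod.mk i) (linearPolynomial ψ)) (Pi.single i 1) := by
  simp only [linearPolynomial_apply, map_sum, map_smul, rename_X]
  exact IsWeightedHomogeneous.sum _ _ _ fun j _ =>
    (weightedHomogeneousSubmodule k _ _).smul_mem _ (isWeightedHomogeneous_X k _ (i, j))

theorem eval_rename_linearPolynomial {m : ℕ} (i : Fin m) (ψ : Module.Dual k D) (l : Fin m → D) :
    eval (fun x : Fin m × Fin (Module.finrank k D) => coords (k := k) (l x.1) x.2)
      (rename (Prod.mk i) (linearPolynomial ψ)) = ψ (l i) := by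
  rw [eval_rename]
  exact eval_coords_linearPolynomial ψ (l i)

theorem GenericTuple.of_eval_ne_zero {L : Set (ℙ k D)} {m : ℕ} {P : (Fin m → ℙ k D) → Prop}
    {F : MvPolynomial (Fin m × Fin (Module.finrank k D)) k} {d : Fin m → ℕ}
    (hF : IsMultihomogeneous F d) {ℓ₀ : Fin m → ℙ k D} (hℓ₀ : ∀ i, ℓ₀ i ∈ L)
    (hFℓ₀ : eval (fun x => coords (k := k) (ℓ₀ x.1).rep x.2) F ≠ 0)
    (hP : ∀ ℓ : Fin m → ℙ k D, eval (fun x => coords (k := k) (ℓ x.1).rep x.2) F ≠ 0 → P ℓ) :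
    GenericTuple L m P :=
  ⟨{ℓ | eval (fun x => coords (k := k) (ℓ x.1).rep x.2) F = 0},
    ⟨{F}, by simpa using ⟨d, hF⟩, by simp⟩, ⟨ℓ₀, hℓ₀, hFℓ₀⟩, fun ℓ _ hℓ => hP ℓ hℓ⟩

theorem GenericTuple.mono {L : Set (ℙ k D)} {m : ℕ} {P Q : (Fin m → ℙ k D) → Prop}
    (hP : GenericTuple L m P) (hPQ : ∀ ℓ, P ℓ → Q ℓ) : GenericTuple L m Q :=
  hP.imp fun _ ⟨hZ, hne, hPZ⟩ => ⟨hZ, hne, fun ℓ hℓL hℓ => hPQ ℓ (hPZ ℓ hℓL hℓ)⟩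

theorem genericTuple_span_range_eq_top [FiniteDimensional k E] {L : Set (ℙ k D)} {m : ℕ}
    {A : Type*} (B : A → D →ₗ[k] E) {ℓ₀ : Fin m → ℙ k D} (hℓ₀ : ∀ i, ℓ₀ i ∈ L)
    (hspan : Submodule.span k (Set.range fun x : Fin m × A => B x.2 (ℓ₀ x.1).rep) = ⊤) :
    GenericTuple L m fun ℓ =>
      Submodule.span k (Set.range fun x : Fin m × A => B x.2 (ℓ x.1).rep) = ⊤ := by
  classical
  obtain ⟨κ, a, -, hspan_a, hli⟩ :=
    exists_linearIndependent' k fun x : Fin m × A => B x.2 (ℓ₀ x.1).rep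
  let b : Module.Basis κ k E := Module.Basis.mk hli (by rw [hspan_a, hspan])
  have : Fintype κ := FiniteDimensional.fintypeBasisIndex b
  let N : Matrix κ κ (MvPolynomial (Fin m × Fin (Module.finrank k D)) k) :=
    Matrix.of fun s r => rename (Prod.mk (a r).1) (linearPolynomial (b.coord s ∘ₗ B (a r).2))
  have heval (l : Fin m → D) : eval (fun x => coords (k := k) (l x.1) x.2) N.det =
      b.det fun r => B (a r).2 (l (a r).1) := by
    rw [RingHom.map_det, Module.Basis.det_apply]
    congr 1
    ext s r
    exact eval_rename_linearPolynomial _ _ l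
  have hN : IsMultihomogeneous N.det (∑ r, Pi.single (a r).1 1) :=
    isWeightedHomogeneous_det fun s r => isMultihomogeneous_rename_linearPolynomial _ _
  refine .of_eval_ne_zero hN hℓ₀ ?_ fun ℓ hℓ => ?_
  · have hb : (fun r => B (a r).2 (ℓ₀ (a r).1).rep) = b := by ext; simp [b]
    rw [heval fun i => (ℓ₀ i).rep, hb, b.det_self]
    exact one_ne_zero
  · rw [heval fun i => (ℓ i).rep] at hℓ
    rw [eq_top_iff, ← ((Module.Basis.is_basis_iff_det b).2 (isUnit_iff_ne_zero.2 hℓ)).2]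
    exact Submodule.span_mono (Set.range_comp_subset_range a fun x => B x.2 (ℓ x.1).rep)

theorem genericTuple_span_range_eq {M : Type*} [AddCommGroup M] [Module k M] {L : Set (ℙ k D)}
    {m : ℕ} {A : Type*} {E : Submodule k M} [FiniteDimensional k E] {B : A → D →ₗ[k] M}
    (hB : ∀ a φ, B a φ ∈ E) {ℓ₀ : Fin m → ℙ k D} (hℓ₀ : ∀ i, ℓ₀ i ∈ L)
    (hspan : Submodule.span k (Set.range fun x : Fin m × A => B x.2 (ℓ₀ x.1).rep) = E) :
    GenericTuple L m fun ℓ =>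
      Submodule.span k (Set.range fun x : Fin m × A => B x.2 (ℓ x.1).rep) = E := by
  let B' (a : A) : D →ₗ[k] E := (B a).codRestrict E (hB a)
  have hspan_iff (ℓ : Fin m → ℙ k D) :
      Submodule.span k (Set.range fun x : Fin m × A => B' x.2 (ℓ x.1).rep) = ⊤ ↔
        Submodule.span k (Set.range fun x : Fin m × A => B x.2 (ℓ x.1).rep) = E := by
    rw [← (Submodule.map_injective_of_injective E.injective_subtype).eq_iff, Submodule.map_span,
      ← Set.range_comp, Submodule.map_top, Submodule.range_subtype]
    rfl
  exact (genericTuple_span_range_eq_top B' hℓ₀ ((hspan_iff ℓ₀).2 hspan)).mono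
    fun ℓ => (hspan_iff ℓ).1

end Multihomogeneous

section GenericSection

open MvPolynomial

attribute [local instance] MvPolynomial.gradedAlgebra

variable {k V : Type*} [Field k] [AddCommGroup V] [Module k V]

theorem mem_annihilator_iff {m : ℕ} {ℓ : Fin m → ℙ k (Module.Dual k V)} {v : V} :
    v ∈ annihilator ℓ ↔ ∀ i, (ℓ i).rep v = 0 := by
  simp only [annihilator, Submodule.dualCoannihilator_iSup_eq, Submodule.mem_iInf,
    Projectivization.submodule_eq, Submodule.mem_dualCoannihilator,
    Submodule.mem_span_singleton, forall_exists_index, forall_apply_eq_imp_iff]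
  exact forall_congr' fun i => ⟨fun h => by simpa using h 1, fun h c => by simp [h]⟩

variable [FiniteDimensional k V] {L : Set (ℙ k (Module.Dual k V))} {m : ℕ}

theorem genericTuple_homogeneousSubmodule_le
    {I : Ideal (MvPolynomial (Fin (Module.finrank k V)) k)}
    (hI : I.IsHomogeneous (homogeneousSubmodule _ k)) {d : ℕ}
    {ℓ₀ : Fin m → ℙ k (Module.Dual k V)} (hℓ₀ : ∀ i, ℓ₀ i ∈ L)
    (hd : homogeneousSubmodule _ k (1 + d) ≤
      (I ⊔ Ideal.span (Set.range fun i => linearPolynomial (ℓ₀ i).rep)).restrictScalars k) :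
    GenericTuple L m fun ℓ => homogeneousSubmodule _ k (1 + d) ≤
      (I ⊔ Ideal.span (Set.range fun i => linearPolynomial (ℓ i).rep)).restrictScalars k := by
  let σ := Fin (Module.finrank k V)
  let E : Submodule k (MvPolynomial σ k ⧸ I) :=
    (homogeneousSubmodule σ k (1 + d)).map (Ideal.Quotient.mkₐ k I).toLinearMap
  have : FiniteDimensional k E :=
    Module.Finite.iff_fg.2 ((homogeneousSubmodule_fg σ k (1 + d)).map _)
  let B (g : homogeneousSubmodule σ k d) : Module.Dual k V →ₗ[k] MvPolynomial σ k ⧸ I :=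
    (Ideal.Quotient.mkₐ k I).toLinearMap ∘ₗ LinearMap.mulRight k g.1 ∘ₗ linearPolynomial
  have hB (g) (φ : Module.Dual k V) : B g φ ∈ E :=
    Submodule.mem_map_of_mem ((isHomogeneous_linearPolynomial φ).mul g.2)
  have hle_iff (ℓ : Fin m → ℙ k (Module.Dual k V)) :=
    homogeneousSubmodule_le_sup_span_range_iff (d := d) hI
      fun i => isHomogeneous_linearPolynomial (ℓ i).rep
  exact (genericTuple_span_range_eq hB hℓ₀ ((hle_iff ℓ₀).1 hd)).mono fun ℓ => (hle_iff ℓ).2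

theorem eq_zero_of_homogeneousSubmodule_le {C : Set V} {d : ℕ} {l : Fin m → Module.Dual k V}
    (hd : homogeneousSubmodule _ k d ≤ (vanishingIdeal k (coords (k := k) '' C) ⊔
      Ideal.span (Set.range fun i => linearPolynomial (l i))).restrictScalars k)
    {v : V} (hvC : v ∈ C) (hlv : ∀ i, l i v = 0) : v = 0 := by
  have hker : vanishingIdeal k (coords (k := k) '' C) ⊔
      Ideal.span (Set.range fun i => linearPolynomial (l i)) ≤
        RingHom.ker (eval (coords (k := k) v)) := by
    refine sup_le (fun f hf => hf _ ⟨v, hvC, rfl⟩) (Ideal.span_le.2 ?_)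
    rintro _ ⟨i, rfl⟩
    exact (eval_coords_linearPolynomial _ v).trans (hlv i)
  have hcoords (j) : coords (k := k) v j = 0 := by
    have hX : eval (coords (k := k) v) (X j ^ d) = 0 := hker (hd (isHomogeneous_X_pow j d))
    rw [map_pow, eval_X] at hX
    exact eq_zero_of_pow_eq_zero hX
  exact (Module.finBasis k V).repr.map_eq_zero_iff.1 (Finsupp.ext hcoords)

theorem IsIrreducibleVariety.exists_forall_linearPolynomial_rep_notMem
    (hL : IsIrreducibleVariety L) (hLnd : IsLinearlyNondegenerate L)
    {F : Set (Ideal (MvPolynomial (Fin (Module.finrank k V)) k))} (hF : F.Finite)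
    (hle : ∀ P ∈ F, ¬ idealOfVars _ k ≤ P) :
    ∃ ℓ ∈ L, ∀ P ∈ F, linearPolynomial ℓ.rep ∉ P := by
  obtain ⟨ℓ, hℓ, hℓF⟩ := hL.exists_forall_rep_notMem hLnd
    (hF.image fun P => (P.restrictScalars k).comap linearPolynomial) (by
      rintro _ ⟨P, hP, rfl⟩ htop
      refine hle P hP (Ideal.span_le.2 ?_)
      rintro _ ⟨j, rfl⟩
      rw [← linearPolynomial_coord]
      exact (Submodule.eq_top_iff'.1 htop) _)
  exact ⟨ℓ, hℓ, fun P hP hℓP => hℓF _ ⟨P, hP, rfl⟩ hℓP⟩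

theorem genericTuple_forall_mem_annihilator_eq_zero [Infinite k] {C : Set V}
    (hC : ∀ c : k, ∀ v ∈ C, c • v ∈ C)
    (hdim : ringKrullDim (MvPolynomial (Fin (Module.finrank k V)) k ⧸
      vanishingIdeal k (coords (k := k) '' C)) ≤ m)
    (hL : IsIrreducibleVariety L) (hLnd : IsLinearlyNondegenerate L) :
    GenericTuple L m fun ℓ => ∀ v ∈ C, v ∈ annihilator ℓ → v = 0 := by
  have hI : (vanishingIdeal k (coords (k := k) '' C)).IsHomogeneous (homogeneousSubmodule _ k) := by
    refine isHomogeneous_vanishingIdeal ?_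
    rintro c _ ⟨v, hv, rfl⟩
    exact ⟨c • v, hC c v hv, map_smul (Module.finBasis k V).equivFun c v⟩
  obtain ⟨t, htL, ht⟩ := exists_idealOfVars_le_radical_sup_span_range
    (T := (fun ℓ => linearPolynomial ℓ.rep) '' L)
    (by rintro _ ⟨ℓ, -, rfl⟩; exact ⟨1, isHomogeneous_linearPolynomial _⟩)
    (fun F hF hle => by
      simpa only [Set.exists_mem_image] using
        hL.exists_forall_linearPolynomial_rep_notMem hLnd hF hle) hI hdim
  choose ℓ₀ hℓ₀L hℓ₀ using htL
  obtain ⟨d, hd⟩ := exists_forall_homogeneousSubmodule_le_of_idealOfVars_le_radical ht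
  obtain rfl : (fun i => linearPolynomial (ℓ₀ i).rep) = t := funext hℓ₀
  refine (genericTuple_homogeneousSubmodule_le hI hℓ₀L (hd (1 + d) le_add_self)).mono ?_
  intro ℓ hℓ v hv hvℓ
  exact eq_zero_of_homogeneousSubmodule_le hℓ hv (mem_annihilator_iff.1 hvℓ)

end GenericSection

section Join

open Pointwise

variable {k V : Type*} [Field k] [AddCommGroup V] [Module k V] {X : Set (ℙ k V)} {p : ℙ k V}

theorem rep_mem_affineCone (hp : p ∈ X) : p.rep ∈ affineCone X :=
  Or.inr ⟨p.rep_nonzero, by rwa [p.mk_rep]⟩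

theorem smul_mem_affineCone {v : V} (hv : v ∈ affineCone X) (c : k) : c • v ∈ affineCone X := by
  by_cases hcv : c • v = 0
  · exact Or.inl hcv
  obtain rfl | ⟨hv0, hvX⟩ := hv
  · exact (hcv (smul_zero c)).elim
  · refine Or.inr ⟨hcv, ?_⟩
    rwa [(Projectivization.mk_eq_mk_iff' k _ _ hcv hv0).2 ⟨c, rfl⟩]

/-- The affine cone over the join of `X` with the point `p`, that is, over the union of `p` and
the lines joining `p` to the points of `X`. -/
def joinCone (X : Set (ℙ k V)) (p : ℙ k V) : Set V :=
  affineCone X + (p.submodule : Set V)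

theorem add_smul_rep_mem_joinCone {v : V} (hv : v ∈ affineCone X) (c : k) :
    v + c • p.rep ∈ joinCone X p :=
  Set.add_mem_add hv (by
    rw [Projectivization.submodule_eq]
    exact Submodule.smul_mem _ c (Submodule.mem_span_singleton_self _))

theorem smul_mem_joinCone (c : k) {v : V} (hv : v ∈ joinCone X p) : c • v ∈ joinCone X p := by
  obtain ⟨x, hx, y, hy, rfl⟩ := hv
  exact ⟨c • x, smul_mem_affineCone hx c, c • y, p.submodule.smul_mem c hy, (smul_add c x y).symm⟩

theorem ringKrullDim_joinCone_le [FiniteDimensional k V] (X : Set (ℙ k V)) (p : ℙ k V) :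
    ringKrullDim (MvPolynomial (Fin (Module.finrank k V)) k ⧸
      MvPolynomial.vanishingIdeal k (coords (k := k) '' joinCone X p)) ≤
        ringKrullDim (HomogeneousCoordinateRing X) + 1 := by
  have himage : coords (k := k) '' joinCone X p = coords (k := k) '' affineCone X +
      (k ∙ coords (k := k) p.rep : Set (Fin (Module.finrank k V) → k)) := by
    let e : V →ₗ[k] Fin (Module.finrank k V) → k := (Module.finBasis k V).equivFun.toLinearMap
    change e '' (affineCone X + p.submodule) = e '' affineCone X + (k ∙ e p.rep : Submodule k _)
    rw [Set.image_add, ← Submodule.map_coe, Projectivization.submodule_eq, Submodule.map_span,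
      Set.image_singleton]
  rw [himage]
  exact ringKrullDim_quotient_vanishingIdeal_add_span_singleton_le _ _

theorem subset_projectionDomain {W : Submodule k V} (hW : ∀ v ∈ affineCone X, v ∈ W → v = 0) :
    X ⊆ projectionDomain W := by
  intro q hq hqW
  rw [Projectivization.submodule_eq, Submodule.span_singleton_le_iff_mem] at hqW
  exact q.rep_nonzero (hW _ (rep_mem_affineCone hq) hqW)

theorem linearProjection_eq_iff {W : Submodule k V} {q p : projectionDomain W} :
    linearProjection W q = linearProjection W p ↔ ∃ c : k, q.1.rep - c • p.1.rep ∈ W := by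
  rw [linearProjection, linearProjection, Projectivization.mk_eq_mk_iff']
  refine exists_congr fun c => ?_
  rw [← map_smul, eq_comm, Submodule.mkQ_apply, Submodule.mkQ_apply, Submodule.Quotient.eq]

theorem exists_subset_projectionDomain_preimage_eq_singleton (hp : p ∈ X) {W : Submodule k V}
    (hW : ∀ v ∈ joinCone X p, v ∈ W → v = 0) :
    ∃ hdef : X ⊆ projectionDomain W,
      (fun q : X => linearProjection W ⟨q.1, hdef q.2⟩) ⁻¹'
        {linearProjection W ⟨p, hdef hp⟩} = {(⟨p, hp⟩ : X)} := by
  refine ⟨subset_projectionDomain fun v hv => hW v ?_, ?_⟩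
  · simpa using add_smul_rep_mem_joinCone (p := p) hv 0
  ext ⟨q, hq⟩
  refine ⟨fun hqp => Subtype.ext ?_, fun hqp => by cases hqp; rfl⟩
  obtain ⟨c, hc⟩ := linearProjection_eq_iff.1 hqp
  have hzero : q.rep - c • p.rep = 0 :=
    hW _ (by simpa [sub_eq_add_neg] using
      add_smul_rep_mem_joinCone (p := p) (rep_mem_affineCone hq) (-c)) hc
  change q = p
  rw [← q.mk_rep, ← p.mk_rep, Projectivization.mk_eq_mk_iff']
  exact ⟨c, (sub_eq_zero.1 hzero).symm⟩

end Join

end ProjGeom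

theorem mainTheorem3_general {k : Type*} [Field k] [Infinite k]
    {V : Type*} [AddCommGroup V] [Module k V] [FiniteDimensional k V]
    (X : Set (ℙ k V)) (m : ℕ) (hm : ringKrullDim (ProjGeom.HomogeneousCoordinateRing X) + 1 ≤ m)
    (L : Set (ℙ k (Module.Dual k V)))
    (hLirr : ProjGeom.IsIrreducibleVariety L)
    (hLnd : ProjGeom.IsLinearlyNondegenerate L)
    (p : ℙ k V) (hp : p ∈ X) :
    ProjGeom.GenericTuple L m fun ℓ =>
      ∃ hdef : X ⊆ ProjGeom.projectionDomain (ProjGeom.annihilator ℓ),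
        (fun q : X => ProjGeom.linearProjection (ProjGeom.annihilator ℓ) ⟨q.1, hdef q.2⟩) ⁻¹'
            {ProjGeom.linearProjection (ProjGeom.annihilator ℓ) ⟨p, hdef hp⟩} =
          {(⟨p, hp⟩ : X)} := by
  have hdim := (ProjGeom.ringKrullDim_joinCone_le X p).trans hm
  have hgeneric := ProjGeom.genericTuple_forall_mem_annihilator_eq_zero
    (fun c _ => ProjGeom.smul_mem_joinCone c) hdim hLirr hLnd
  exact hgeneric.mono fun _ hW =>
    ProjGeom.exists_subset_projectionDomain_preimage_eq_singleton hp hW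

theorem mainTheorem3 {k : Type*} [Field k] [Infinite k]
    {V : Type*} [AddCommGroup V] [Module k V] [FiniteDimensional k V]
    (X : Set (ℙ k V)) (hX : ProjGeom.IsZariskiClosed X)
    (n : ℕ) (hn : ProjGeom.HasDimension X n)
    (L : Set (ℙ k (Module.Dual k V))) (hL : ProjGeom.IsZariskiClosed L)
    (hLirr : ProjGeom.IsIrreducibleVariety L)
    (hLnd : ProjGeom.IsLinearlyNondegenerate L)
    (p : ℙ k V) (hp : p ∈ X) :
    ProjGeom.GenericTuple L (n + 2) fun ℓ =>
      ∃ hdef : X ⊆ ProjGeom.projectionDomain (ProjGeom.annihilator ℓ),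
        (fun q : X => ProjGeom.linearProjection (ProjGeom.annihilator ℓ) ⟨q.1, hdef q.2⟩) ⁻¹'
            {ProjGeom.linearProjection (ProjGeom.annihilator ℓ) ⟨p, hdef hp⟩} =
          {(⟨p, hp⟩ : X)} :=
  mainTheorem3_general X (n + 2) (congrArg (· + 1) hn).le L hLirr hLnd p hp
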